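/- Let $m=(m_0,m_1,\dots)$ be a bounded sequence of integers $m_i\ge 2$, let $M:=\sup_i m_i$, $M_0:=1$, $M_{k+1}:=m_kM_k$, and let $G_m=\prod_{i\ge 0} \mathbb Z_{m_i}$ be the corresponding (bounded) Vilenkin group with its normalized Haar measure $\mu$ (the product of the uniform measures). Let $\mathcal F_n$ be the $\sigma$-algebra generated by the sets $I_n(x)=\{y\in G_m: y_0=x_0,\dots,y_{n-1}=x_{n-1}\}$, $x\in G_m$. Write $\|g\|_{1/2}=\big(\int_{G_m}|g|^{1/2}\,d\mu\big)^2$. The martingale Hardy space $H_{1/2}$ consists of the (complex-valued) martingales $f=(f^{(n)})_{n\ge 0}$ with respect to $(\mathcal F_n)_{n\ge 0}$ such that $\|\sup_n|f^{(n)}|\,\|_{1/2}<\infty$. Writing $n=\sum_k n_kM_k$ with $0\le n_k<m_k$, the Vilenkin functions are $\psi_n(x)=\prod_k \exp(2\pi i x_k/m_k)^{n_k}$, and the Dirichlet kernels are $D_n=\sum_{k=0}^{n-1}\psi_k$. For a martingale $f$ put $\widehat f(i)=\lim_{k\to\infty}\int_{G_m} f^{(k)}\overline{\psi_i}\,d\mu$,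 $S_nf=\sum_{k=0}^{n-1}\widehat f(k)\psi_k$ and $\sigma_nf=\frac1n\sum_{k=0}^{n-1}S_kf$ for $n\ge 1$. Theorem 1. There is a martingale $f\in H_{1/2}$ such that $$\sup_{n\ge 1}\|\sigma_nf\|_{1/2}=+\infty .$$ More precisely, there are strictly increasing sequences $(\alpha_k)_{k\ge 0}$ of positive integers such that $$\sum_{k=0}^\infty \alpha_k^{-1/2}<\infty,\qquad \sum_{\eta=0}^{k-1}\frac{M_{2\alpha_\eta}^2}{\alpha_\eta}<\frac{M_{2\alpha_k}^2}{\alpha_k}\quad(k\ge 0),\qquad \frac{32M\,M_{2\alpha_{k-1}}^2}{\alpha_{k-1}}<\frac{M_{\alpha_k}}{\alpha_k}\quad(k\ge 1),$$ and for every such sequence the following holds: with $$a_k=\frac{M_{2\alpha_k}}{M}\big(D_{M_{2\alpha_k+1}}-D_{M_{2\alpha_k}}\big),\qquad f^{(A)}=\sum_{k:\,2\alpha_k<A}\frac{1}{\alpha_k}\,a_k\quad(A\ge 0),$$ the sequence $f=(f^{(A)})_{A\ge 0}$ is a martingale in $H_{1/2}$, and $$\lim_{k\to\infty}\|\sigma_{q_{\alpha_k}}f\|_{1/2}=+\infty,\qquad\text{where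 } q_A=M_{2A}+M_{2A-2}+\dots+M_2+M_0 .$$ -/

import Mathlib

open MeasureTheory Filter Topology
open scoped ENNReal

namespace Vilenkin

/-- The Vilenkin group `G_m = ∏ i, Z_{m_i}` (with its product group structure, product topology and
product `σ`-algebra, all provided by Mathlib). -/
abbrev VGroup (m : ℕ → ℕ) : Type := ∀ i : ℕ, ZMod (m i)

/-- The Haar measure on `G_m`: the product of the uniform probability measures on the `Z_{m_i}`. -/
noncomputable def haar (m : ℕ → ℕ) : Measure (VGroup m) :=
  Measure.infinitePi fun i => ProbabilityTheory.uniformOn (Set.univ : Set (ZMod (m i)))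

/-- The interval `I_n(x) = {y | y_0 = x_0, …, y_{n-1} = x_{n-1}}`. -/
def cyl (m : ℕ → ℕ) (n : ℕ) (x : VGroup m) : Set (VGroup m) :=
  {y | ∀ i < n, y i = x i}

/-- A countable union argument: `I_n(x)` belongs to the `σ`-algebra generated by the intervals of any
rank `n' ≥ n`. -/
theorem measurableSet_cyl_of_le (m : ℕ → ℕ) {n n' : ℕ} (h : n ≤ n') (x : VGroup m) :
    MeasurableSet[MeasurableSpace.generateFrom (Set.range (cyl m n'))] (cyl m n x) := by
  have hc : ∀ k : ℕ, Countable (ZMod k) := fun k => by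
    cases k with
    | zero => exact inferInstanceAs (Countable ℤ)
    | succ k => exact inferInstanceAs (Countable (Fin (k + 1)))
  have hcount : (cyl m n' '' cyl m n x).Countable := by
    have : Set.Countable (Set.range (cyl m n')) := by
      have hsub : Set.range (cyl m n') ⊆ Set.range
          (fun z : (∀ i : Fin n', ZMod (m i)) => {y : VGroup m | ∀ i : Fin n', y i = z i}) := by
        rintro _ ⟨y, rfl⟩
        refine ⟨fun i => y i, ?_⟩
        ext w
        exact ⟨fun hw i hi => hw ⟨i, hi⟩, fun hw i => hw i i.2⟩
      exact (Set.countable_range _).mono hsub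
    exact this.mono (Set.image_subset_range _ _)
  have heq : cyl m n x = ⋃₀ (cyl m n' '' cyl m n x) := by
    ext y
    constructor
    · intro hy
      exact ⟨cyl m n' y, ⟨y, hy, rfl⟩, fun _ _ => rfl⟩
    · rintro ⟨_, ⟨z, hz, rfl⟩, hy⟩ i hi
      exact (hy i (hi.trans_le h)).trans (hz i hi)
  rw [heq]
  refine MeasurableSet.sUnion hcount ?_
  rintro _ ⟨z, -, rfl⟩
  exact MeasurableSpace.measurableSet_generateFrom ⟨z, rfl⟩

theorem measurableSet_cyl (m : ℕ → ℕ) (n : ℕ) (x : VGroup m) : MeasurableSet (cyl m n x) := by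
  have : cyl m n x = ⋂ i, ⋂ (_ : i < n), (fun y : VGroup m => y i) ⁻¹' {x i} := by
    ext y; simp [cyl]
  rw [this]
  exact MeasurableSet.iInter fun i => MeasurableSet.iInter fun _ =>
    measurable_pi_apply i (measurableSet_singleton _)

/-- The filtration `F_n`: the `σ`-algebra generated by the intervals `I_n(x)`, `x ∈ G_m`. -/
def filt (m : ℕ → ℕ) : Filtration ℕ (inferInstance : MeasurableSpace (VGroup m)) where
  seq n := MeasurableSpace.generateFrom (Set.range (cyl m n))
  mono' := by
    intro n n' h
    refine MeasurableSpace.generateFrom_le ?_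
    rintro _ ⟨x, rfl⟩
    exact measurableSet_cyl_of_le m h x
  le' := by
    intro n
    refine MeasurableSpace.generateFrom_le ?_
    rintro _ ⟨x, rfl⟩
    exact measurableSet_cyl m n x

/-- The generalized powers `M_0 = 1`, `M_{k+1} = m_k M_k`. -/
def bigM (m : ℕ → ℕ) : ℕ → ℕ
  | 0 => 1
  | k + 1 => m k * bigM m k

/-- The digit `n_k` in the expansion `n = ∑ n_k M_k`, `0 ≤ n_k < m_k`. -/
def digit (m : ℕ → ℕ) (n k : ℕ) : ℕ := n / bigM m k % m k

/-- The generalized Rademacher function `r_k(x) = exp (2 π i x_k / m_k)`. -/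
noncomputable def rad (m : ℕ → ℕ) (k : ℕ) (x : VGroup m) : ℂ :=
  Complex.exp (2 * Real.pi * Complex.I * ((x k).val : ℂ) / (m k : ℂ))

/-- The Vilenkin function `ψ_n = ∏_k r_k ^ {n_k}`. If all `m_i ≥ 2` then `n < 2 ^ n ≤ M_n`, so that
the digits `n_k` with `k ≥ n` vanish and the product may be taken over `k < n`. -/
noncomputable def psi (m : ℕ → ℕ) (n : ℕ) (x : VGroup m) : ℂ :=
  ∏ k ∈ Finset.range n, rad m k x ^ digit m n k

/-- The Dirichlet kernel `D_n = ∑_{k < n} ψ_k`. -/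
noncomputable def dirichlet (m : ℕ → ℕ) (n : ℕ) (x : VGroup m) : ℂ :=
  ∑ k ∈ Finset.range n, psi m k x

/-- The maximal function `f^* = sup_n |f^{(n)}|` of a sequence of functions, with values in
`[0, ∞]`. -/
noncomputable def maximal (m : ℕ → ℕ) (f : ℕ → VGroup m → ℂ) (x : VGroup m) : ℝ≥0∞ :=
  ⨆ n : ℕ, ‖f n x‖ₑ

/-- `f` is a martingale with respect to `(F_n)` that belongs to the martingale Hardy space `H_p`:
`‖f‖_{H_p} = ‖f^*‖_p < ∞`. -/
def MemHardy (m : ℕ → ℕ) (p : ℝ≥0∞) (f : ℕ → VGroup m → ℂ) : Prop :=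
  Martingale f (filt m) (haar m) ∧ eLpNorm (maximal m f) p (haar m) < ∞

/-- The Vilenkin–Fourier coefficient `lim_k ∫ f^{(k)} conj(ψ_i) dμ` of a martingale. The sequence is
constant for `k ≥ i`, so that the limit exists. -/
noncomputable def coeff (m : ℕ → ℕ) (f : ℕ → VGroup m → ℂ) (i : ℕ) : ℂ :=
  limUnder atTop fun k : ℕ => ∫ x, f k x * (starRingEnd ℂ) (psi m i x) ∂(haar m)

/-- The partial sum `S_n f = ∑_{k < n} f̂(k) ψ_k`. -/
noncomputable def partialSum (m : ℕ → ℕ) (f : ℕ → VGroup m → ℂ) (n : ℕ) (x : VGroup m) : ℂ :=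
  ∑ k ∈ Finset.range n, coeff m f k * psi m k x

/-- The Fejér mean `σ_n f = (1 / n) ∑_{k < n} S_k f` (for `n ≥ 1`). -/
noncomputable def fejer (m : ℕ → ℕ) (f : ℕ → VGroup m → ℂ) (n : ℕ) (x : VGroup m) : ℂ :=
  (1 / (n : ℂ)) * ∑ k ∈ Finset.range n, partialSum m f k x

/-- `M = sup_i m_i`. -/
noncomputable def supM (m : ℕ → ℕ) : ℕ := ⨆ i, m i

/-- `q_A = M_{2A} + M_{2A-2} + … + M_2 + M_0`. -/
def bigQ (m : ℕ → ℕ) (A : ℕ) : ℕ := ∑ i ∈ Finset.range (A + 1), bigM m (2 * i)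

/-- The growth conditions on the sequence `(α_k)` of the example. -/
structure FastGrowing (m : ℕ → ℕ) (α : ℕ → ℕ) : Prop where
  strictMono : StrictMono α
  pos : ∀ k, 0 < α k
  summable : Summable fun k => (α k : ℝ) ^ (-(1 / 2) : ℝ)
  sum_lt : ∀ k, ∑ η ∈ Finset.range k, (bigM m (2 * α η) : ℝ) ^ 2 / (α η : ℝ) <
    (bigM m (2 * α k) : ℝ) ^ 2 / (α k : ℝ)
  lt_next : ∀ k, 32 * (supM m : ℝ) * (bigM m (2 * α k) : ℝ) ^ 2 / (α k : ℝ) <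
    (bigM m (α (k + 1)) : ℝ) / (α (k + 1) : ℝ)

/-- `a_k = (M_{2 α_k} / M) (D_{M_{2 α_k + 1}} - D_{M_{2 α_k}})`. -/
noncomputable def exampleAtom (m α : ℕ → ℕ) (k : ℕ) (x : VGroup m) : ℂ :=
  ((bigM m (2 * α k) : ℂ) / (supM m : ℂ)) *
    (dirichlet m (bigM m (2 * α k + 1)) x - dirichlet m (bigM m (2 * α k)) x)

/-- The martingale `f = ∑_k a_k / α_k`, that is, `f^{(A)} = ∑_{k : 2 α_k < A} a_k / α_k`. Since `α` is
strictly increasing, `2 α_k < A` forces `k < A`. -/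
noncomputable def exampleMartingale (m α : ℕ → ℕ) (A : ℕ) (x : VGroup m) : ℂ :=
  ∑ k ∈ Finset.range A with 2 * α k < A, (1 / (α k : ℂ)) * exampleAtom m α k x

end Vilenkin

open Vilenkin

/-! The atom `a_k` is supported on $I_{2\alpha_k}(0)$, of measure $1/M_{2\alpha_k}$, and bounded
there by $M_{2\alpha_k}^2$. Subadditivity of the square root therefore bounds $\int (f^*)^{1/2}$ by
$\sum_k \alpha_k^{-1/2}$, which gives `memHardy_exampleMartingale`.

For divergence, put $n+1=\alpha_k$, so that $q_{n+1}=M_{2n+2}+q_n$. The spectrum of `a_k` is the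
block $[M_{2\alpha_k},M_{2\alpha_k+1})$, with equal coefficients. Hence $q_{n+1}\sigma_{q_{n+1}}f$
is the contribution of the older blocks plus a constant times $r_{2n+2}\sum_{l<q_n}D_l$
(`fejer_bigQ`). The growth conditions make the older blocks negligible.

The kernel sum is large on the sets `spike m s`: the two nonzero coordinates kill the pieces of
$q_n$ of index above $2s+2$, the piece $M_{2s+2}$ gives at least $M_{2s}M_{2s+2}/2$, and the smaller
pieces cannot cancel it (`le_norm_dirichletSum_bigQ`). So $|\sigma_{q_{n+1}}f|^{1/2}\ge
cM_{2s}\alpha_k^{-1/2}$ on a set of measure comparable to $1/M_{2s}$, with constants depending only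
on $M$. Each spike contributes at least $c\alpha_k^{-1/2}$ to the integral. About $\alpha_k/2$
disjoint spikes are available, so the integral is at least $c\alpha_k^{1/2}$, and its square tends
to infinity. -/

namespace Vilenkin

/-! ### Mixed-radix digits and the characters $\psi_n$. -/

section Arithmetic

variable {m : ℕ → ℕ}

theorem bigM_succ (m : ℕ → ℕ) (k : ℕ) : bigM m (k + 1) = m k * bigM m k := rfl

theorem bigM_pos (hm : ∀ i, 2 ≤ m i) (n : ℕ) : 0 < bigM m n := by
  induction n with
  | zero => exact Nat.one_pos
  | succ n ih => exact Nat.mul_pos (by have := hm n; omega) ih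

theorem two_mul_bigM_le (hm : ∀ i, 2 ≤ m i) (n : ℕ) : 2 * bigM m n ≤ bigM m (n + 1) :=
  Nat.mul_le_mul_right _ (hm n)

theorem bigM_strictMono (hm : ∀ i, 2 ≤ m i) : StrictMono (bigM m) :=
  strictMono_nat_of_lt_succ fun n => by
    have := two_mul_bigM_le hm n
    have := bigM_pos hm n
    omega

theorem two_pow_le_bigM (hm : ∀ i, 2 ≤ m i) (n : ℕ) : 2 ^ n ≤ bigM m n := by
  induction n with
  | zero => exact le_rfl
  | succ n ih => have := two_mul_bigM_le hm n; rw [pow_succ]; omega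

theorem lt_bigM_self (hm : ∀ i, 2 ≤ m i) (n : ℕ) : n < bigM m n :=
  n.lt_two_pow_self.trans_le (two_pow_le_bigM hm n)

theorem bigM_dvd_bigM (m : ℕ → ℕ) {k n : ℕ} (h : k ≤ n) : bigM m k ∣ bigM m n := by
  induction n, h using Nat.le_induction with
  | base => exact dvd_rfl
  | succ n _ ih => exact ih.mul_left _

theorem digit_eq_zero_of_lt {j k : ℕ} (h : j < bigM m k) : digit m j k = 0 := by
  simp [digit, Nat.div_eq_of_lt h]

theorem digit_mul_add_of_lt (hm : ∀ i, 2 ≤ m i) {k n : ℕ} (h : k < n) (a b : ℕ) :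
    digit m (a * bigM m n + b) k = digit m b k := by
  obtain ⟨t, ht⟩ := bigM_dvd_bigM m (Nat.succ_le_of_lt h)
  have hk := bigM_pos hm k
  have : a * bigM m n + b = b + bigM m k * (m k * (a * t)) := by
    rw [ht, Nat.succ_eq_add_one, bigM_succ]; ring
  rw [digit, this, Nat.add_mul_div_left _ _ hk, Nat.add_mul_mod_self_left, digit]

theorem digit_mul_add_self {a b n : ℕ} (ha : a < m n) (hb : b < bigM m n) :
    digit m (a * bigM m n + b) n = a := by
  have hk : 0 < bigM m n := by omega
  rw [digit, add_comm, Nat.add_mul_div_right _ _ hk, Nat.div_eq_of_lt hb, zero_add,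
    Nat.mod_eq_of_lt ha]

theorem psi_eq_prod (hm : ∀ i, 2 ≤ m i) {j N : ℕ} (h : j < bigM m N) (x : VGroup m) :
    psi m j x = ∏ k ∈ Finset.range N, rad m k x ^ digit m j k := by
  have key : ∀ {a b : ℕ}, a ≤ b → j < bigM m a →
      ∏ k ∈ Finset.range a, rad m k x ^ digit m j k =
        ∏ k ∈ Finset.range b, rad m k x ^ digit m j k := by
    intro a b hab ha
    refine Finset.prod_subset (Finset.range_subset_range.2 hab) fun k _ hk => ?_
    have hk' : a ≤ k := by simpa using hk
    rw [digit_eq_zero_of_lt (ha.trans_le ((bigM_strictMono hm).monotone hk')), pow_zero]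
  rcases le_total j N with hj | hj
  · exact key hj (lt_bigM_self hm j)
  · exact (key hj h).symm

/-- Splitting off the leading digit; all the kernel recursions below come from this. -/
theorem psi_mul_add (hm : ∀ i, 2 ≤ m i) {a b n : ℕ} (ha : a < m n) (hb : b < bigM m n)
    (x : VGroup m) : psi m (a * bigM m n + b) x = rad m n x ^ a * psi m b x := by
  have hlt : a * bigM m n + b < bigM m (n + 1) := by
    rw [bigM_succ]
    calc a * bigM m n + b < a * bigM m n + bigM m n := by omega
      _ = (a + 1) * bigM m n := by ring
      _ ≤ m n * bigM m n := Nat.mul_le_mul_right _ ha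
  rw [psi_eq_prod hm hlt, psi_eq_prod hm hb, Finset.prod_range_succ, digit_mul_add_self ha hb,
    mul_comm]
  congr 1
  refine Finset.prod_congr rfl fun k hk => ?_
  rw [digit_mul_add_of_lt hm (Finset.mem_range.1 hk)]

theorem rad_eq_stdAddChar [∀ i, NeZero (m i)] (k : ℕ) (x : VGroup m) :
    rad m k x = ZMod.stdAddChar (x k) := by
  rw [ZMod.stdAddChar_apply, ZMod.toCircle_apply, rad]

theorem rad_pow_self [∀ i, NeZero (m i)] (k : ℕ) (x : VGroup m) : rad m k x ^ m k = 1 := by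
  rw [rad_eq_stdAddChar, ← AddChar.map_nsmul_eq_pow]
  simp

theorem norm_rad [∀ i, NeZero (m i)] (k : ℕ) (x : VGroup m) : ‖rad m k x‖ = 1 := by
  rw [rad_eq_stdAddChar, ZMod.stdAddChar_apply, Circle.norm_coe]

theorem rad_eq_one_of_eq_zero {k : ℕ} {x : VGroup m} (h : x k = 0) : rad m k x = 1 := by
  simp [rad, h]

theorem rad_ne_one [∀ i, NeZero (m i)] {k : ℕ} {x : VGroup m} (h : x k ≠ 0) :
    rad m k x ≠ 1 := by
  rw [rad_eq_stdAddChar]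
  intro h1
  exact h (ZMod.injective_stdAddChar (h1.trans (AddChar.map_zero_eq_one _).symm))

theorem norm_psi [∀ i, NeZero (m i)] (n : ℕ) (x : VGroup m) : ‖psi m n x‖ = 1 := by
  simp [psi, norm_rad]

theorem psi_eq_one (hm : ∀ i, 2 ≤ m i) {n j : ℕ} (hj : j < bigM m n) {x : VGroup m}
    (hx : ∀ i < n, x i = 0) : psi m j x = 1 := by
  rw [psi_eq_prod hm hj]
  refine Finset.prod_eq_one fun k hk => ?_
  rw [rad_eq_one_of_eq_zero (hx k (Finset.mem_range.1 hk)), one_pow]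

end Arithmetic

/-! ### Dirichlet and Fejér kernels, and the lower bound on spikes. -/

section Kernels

variable {m : ℕ → ℕ}

theorem dirichlet_mul_add (hm : ∀ i, 2 ≤ m i) {a b n : ℕ} (ha : a < m n) (hb : b ≤ bigM m n)
    (x : VGroup m) : dirichlet m (a * bigM m n + b) x =
      dirichlet m (a * bigM m n) x + rad m n x ^ a * dirichlet m b x := by
  rw [dirichlet, Finset.sum_range_add, dirichlet, dirichlet, Finset.mul_sum]
  congr 1
  refine Finset.sum_congr rfl fun k hk => ?_
  exact psi_mul_add hm ha ((Finset.mem_range.1 hk).trans_le hb) x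

theorem dirichlet_mul (hm : ∀ i, 2 ≤ m i) {a n : ℕ} (ha : a ≤ m n) (x : VGroup m) :
    dirichlet m (a * bigM m n) x =
      (∑ c ∈ Finset.range a, rad m n x ^ c) * dirichlet m (bigM m n) x := by
  induction a with
  | zero => simp [dirichlet]
  | succ a ih =>
    rw [Nat.succ_mul, dirichlet_mul_add hm ha le_rfl, ih (by omega), Finset.sum_range_succ]
    ring

theorem sum_rad_pow [∀ i, NeZero (m i)] {k : ℕ} {x : VGroup m} (h : x k ≠ 0) :
    ∑ c ∈ Finset.range (m k), rad m k x ^ c = 0 := by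
  have h1 := geom_sum_mul (rad m k x) (m k)
  rw [rad_pow_self, sub_self] at h1
  exact (mul_eq_zero.1 h1).resolve_right (sub_ne_zero.2 (rad_ne_one h))

theorem dirichlet_bigM_of_mem (hm : ∀ i, 2 ≤ m i) {n : ℕ} {x : VGroup m}
    (hx : ∀ i < n, x i = 0) {l : ℕ} (hl : l ≤ bigM m n) : dirichlet m l x = l := by
  rw [dirichlet, Finset.sum_congr rfl fun k hk =>
    psi_eq_one hm ((Finset.mem_range.1 hk).trans_le hl) hx]
  simp

theorem dirichlet_bigM_of_ne [∀ i, NeZero (m i)] (hm : ∀ i, 2 ≤ m i) {n k : ℕ} {x : VGroup m}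
    (hk : k < n) (hx : x k ≠ 0) : dirichlet m (bigM m n) x = 0 := by
  induction n with
  | zero => omega
  | succ n ih =>
    rw [bigM_succ, dirichlet_mul hm le_rfl]
    rcases Nat.lt_succ_iff_lt_or_eq.1 hk with h | rfl
    · rw [ih h, mul_zero]
    · rw [sum_rad_pow hx, zero_mul]

theorem dirichlet_bigM [∀ i, NeZero (m i)] (hm : ∀ i, 2 ≤ m i) (n : ℕ) :
    dirichlet m (bigM m n) = (cyl m n 0).indicator fun _ => (bigM m n : ℂ) := by
  ext x
  by_cases hx : x ∈ cyl m n 0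
  · rw [Set.indicator_of_mem hx]
    exact dirichlet_bigM_of_mem hm hx le_rfl
  · rw [Set.indicator_of_notMem hx]
    simp only [cyl, Set.mem_ofPred_eq, not_forall] at hx
    obtain ⟨k, hk, hk'⟩ := hx
    exact dirichlet_bigM_of_ne hm hk hk'

/-- The unnormalized Fejér kernel `n K_n = ∑_{l < n} D_l`. -/
noncomputable def dirichletSum (m : ℕ → ℕ) (n : ℕ) (x : VGroup m) : ℂ :=
  ∑ l ∈ Finset.range n, dirichlet m l x

theorem dirichletSum_mul_add (hm : ∀ i, 2 ≤ m i) {a b n : ℕ} (ha : a < m n) (hb : b ≤ bigM m n)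
    (x : VGroup m) : dirichletSum m (a * bigM m n + b) x =
      dirichletSum m (a * bigM m n) x + b * dirichlet m (a * bigM m n) x +
        rad m n x ^ a * dirichletSum m b x := by
  rw [dirichletSum, Finset.sum_range_add, dirichletSum, dirichletSum, Finset.mul_sum, add_assoc]
  congr 1
  rw [Finset.sum_congr rfl fun k hk =>
    dirichlet_mul_add hm ha ((Finset.mem_range.1 hk).le.trans hb) x, Finset.sum_add_distrib]
  simp

theorem dirichletSum_mul (hm : ∀ i, 2 ≤ m i) {a n : ℕ} (ha : a ≤ m n) (x : VGroup m) :
    dirichletSum m (a * bigM m n) x =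
      (∑ i ∈ Finset.range a, ∑ c ∈ Finset.range i, rad m n x ^ c) *
          (bigM m n * dirichlet m (bigM m n) x) +
        (∑ i ∈ Finset.range a, rad m n x ^ i) * dirichletSum m (bigM m n) x := by
  induction a with
  | zero => simp [dirichletSum]
  | succ a ih =>
    rw [Nat.succ_mul, dirichletSum_mul_add hm ha le_rfl, ih (by omega), dirichlet_mul hm (by omega),
      Finset.sum_range_succ, Finset.sum_range_succ]
    ring

/-- In `dirichletSum_mul` at level $l$, the first term dies because $D_{M_l}(x)=0$ and the second
because the full geometric sum in $r_l(x)\ne 1$ is zero. The vanishing then propagates upwards. -/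
theorem dirichletSum_bigM_eq_zero [∀ i, NeZero (m i)] (hm : ∀ i, 2 ≤ m i) {n k l : ℕ}
    {x : VGroup m} (hkl : k < l) (hl : l < n) (hxk : x k ≠ 0) (hxl : x l ≠ 0) :
    dirichletSum m (bigM m n) x = 0 := by
  induction n, hl using Nat.le_induction with
  | base =>
    rw [Nat.succ_eq_add_one, bigM_succ, dirichletSum_mul hm le_rfl, sum_rad_pow hxl,
      dirichlet_bigM_of_ne hm hkl hxk]
    simp
  | succ n hn ih =>
    rw [bigM_succ, dirichletSum_mul hm le_rfl, ih, dirichlet_bigM_of_ne hm (by omega) hxk]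
    simp

/-- Only the $D_{M_k}$ term of the recursion survives. Its double geometric sum is $m_k/(1-r_k)$,
since $\sum_{i<m_k}(1-r_k^i)=m_k$. -/
theorem dirichletSum_bigM_succ [∀ i, NeZero (m i)] (hm : ∀ i, 2 ≤ m i) {k : ℕ}
    {x : VGroup m} (hx : ∀ i < k, x i = 0) (hxk : x k ≠ 0) :
    dirichletSum m (bigM m (k + 1)) x = bigM m k * bigM m (k + 1) / (1 - rad m k x) := by
  have h1 : 1 - rad m k x ≠ 0 := sub_ne_zero.2 (rad_ne_one hxk).symm
  have h2 : (∑ i ∈ Finset.range (m k), ∑ c ∈ Finset.range i, rad m k x ^ c) * (1 - rad m k x) =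
      m k := by
    rw [Finset.sum_mul, Finset.sum_congr rfl fun i _ => geom_sum_mul_neg (rad m k x) i,
      Finset.sum_sub_distrib, sum_rad_pow hxk]
    simp
  rw [eq_div_iff h1, bigM_succ, dirichletSum_mul hm le_rfl, sum_rad_pow hxk,
    dirichlet_bigM_of_mem hm hx le_rfl]
  push_cast
  linear_combination ((bigM m k : ℂ) * bigM m k) * h2

theorem dirichletSum_bigM_add_two [∀ i, NeZero (m i)] (hm : ∀ i, 2 ≤ m i) {k : ℕ}
    {x : VGroup m} (hx : ∀ i < k, x i = 0) (hxk : x k ≠ 0) (hxk' : x (k + 1) = 0) :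
    dirichletSum m (bigM m (k + 2)) x = bigM m k * bigM m (k + 2) / (1 - rad m k x) := by
  rw [bigM_succ m (k + 1), dirichletSum_mul hm le_rfl, dirichlet_bigM_of_ne hm k.lt_succ_self hxk,
    dirichletSum_bigM_succ hm hx hxk, rad_eq_one_of_eq_zero hxk']
  simp
  ring

theorem norm_dirichlet_le [∀ i, NeZero (m i)] (n : ℕ) (x : VGroup m) : ‖dirichlet m n x‖ ≤ n := by
  refine (norm_sum_le _ _).trans ?_
  simp [norm_psi]

theorem norm_dirichletSum_le [∀ i, NeZero (m i)] (n : ℕ) (x : VGroup m) :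
    ‖dirichletSum m n x‖ ≤ (n : ℝ) ^ 2 / 2 := by
  induction n with
  | zero => simp [dirichletSum]
  | succ n ih =>
    rw [dirichletSum, Finset.sum_range_succ]
    refine (norm_add_le _ _).trans ((add_le_add ih (norm_dirichlet_le n x)).trans ?_)
    push_cast
    nlinarith

theorem bigQ_succ (m : ℕ → ℕ) (n : ℕ) : bigQ m (n + 1) = 1 * bigM m (2 * n + 2) + bigQ m n := by
  rw [bigQ, Finset.sum_range_succ, bigQ, one_mul, add_comm]
  rfl

theorem four_mul_bigM_le (hm : ∀ i, 2 ≤ m i) (n : ℕ) : 4 * bigM m n ≤ bigM m (n + 2) := by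
  have h1 := two_mul_bigM_le hm n
  have h2 : 2 * bigM m (n + 1) ≤ bigM m (n + 2) := two_mul_bigM_le hm (n + 1)
  omega

/-- Consecutive terms of $q_n$ grow by a factor at least 4, whence the geometric constant $4/3$. -/
theorem three_mul_bigQ_le (hm : ∀ i, 2 ≤ m i) (n : ℕ) : 3 * bigQ m n ≤ 4 * bigM m (2 * n) := by
  induction n with
  | zero => simp [bigQ, bigM]
  | succ n ih =>
    have := four_mul_bigM_le hm (2 * n)
    rw [bigQ_succ, show 2 * (n + 1) = 2 * n + 2 by ring]
    omega

theorem bigQ_le_bigM (hm : ∀ i, 2 ≤ m i) (n : ℕ) : bigQ m n ≤ bigM m (2 * n + 2) := by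
  have h1 := three_mul_bigQ_le hm n
  have h2 := four_mul_bigM_le hm (2 * n)
  omega

theorem dirichletSum_bigQ_succ (hm : ∀ i, 2 ≤ m i) (n : ℕ) (x : VGroup m) :
    dirichletSum m (bigQ m (n + 1)) x =
      dirichletSum m (bigM m (2 * n + 2)) x + bigQ m n * dirichlet m (bigM m (2 * n + 2)) x +
        rad m (2 * n + 2) x * dirichletSum m (bigQ m n) x := by
  have := dirichletSum_mul_add hm (a := 1) (n := 2 * n + 2) (hm _) (bigQ_le_bigM hm n) x
  rw [bigQ_succ, this, one_mul, pow_one]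

/-- The points with zero coordinates below `2 s + 3`, except for the coordinates `2 s` and
`2 s + 2`, which are `1`. -/
def spike (m : ℕ → ℕ) (s : ℕ) : Set (VGroup m) :=
  cyl m (2 * s + 3) fun i => if i = 2 * s ∨ i = 2 * s + 2 then 1 else 0

theorem one_ne_zero_zmod (hm : ∀ i, 2 ≤ m i) (i : ℕ) : (1 : ZMod (m i)) ≠ 0 := by
  have : Fact (1 < m i) := ⟨hm i⟩
  exact one_ne_zero

/-- Induction on $n$ from $s+1$. Beyond the base case both kernels of order $M_{2n+2}$ vanish on the
spike, so each step only multiplies by a unimodular factor. -/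
theorem le_norm_dirichletSum_bigQ [∀ i, NeZero (m i)] (hm : ∀ i, 2 ≤ m i) {s n : ℕ} (hs : s < n)
    {x : VGroup m} (hx : x ∈ spike m s) :
    (bigM m (2 * s) : ℝ) * bigM m (2 * s + 2) / 4 ≤ ‖dirichletSum m (bigQ m n) x‖ := by
  have hx' : ∀ i < 2 * s + 3, x i = if i = 2 * s ∨ i = 2 * s + 2 then 1 else 0 := hx
  have h0 : ∀ i < 2 * s, x i = 0 := fun i hi => by
    rw [hx' i (by omega), if_neg (by omega)]
  have h1 : x (2 * s) ≠ 0 := by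
    rw [hx' _ (by omega), if_pos (Or.inl rfl)]; exact one_ne_zero_zmod hm _
  have h2 : x (2 * s + 1) = 0 := by
    rw [hx' _ (by omega), if_neg (by omega)]
  have h3 : x (2 * s + 2) ≠ 0 := by
    rw [hx' _ (by omega), if_pos (Or.inr rfl)]; exact one_ne_zero_zmod hm _
  induction n, hs using Nat.le_induction with
  | base =>
    rw [Nat.succ_eq_add_one, dirichletSum_bigQ_succ hm, dirichlet_bigM_of_ne hm (by omega) h1,
      dirichletSum_bigM_add_two hm h0 h1 h2, mul_zero, add_zero]
    have hM := bigM_pos hm (2 * s)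
    have hM' := bigM_pos hm (2 * s + 2)
    have e1 : (bigM m (2 * s) : ℝ) * bigM m (2 * s + 2) / 2 ≤
        ‖(bigM m (2 * s) * bigM m (2 * s + 2) / (1 - rad m (2 * s) x) : ℂ)‖ := by
      have hle : ‖1 - rad m (2 * s) x‖ ≤ 2 := by
        refine (norm_sub_le _ _).trans ?_
        rw [norm_rad, norm_one]; norm_num
      have hpos : 0 < ‖1 - rad m (2 * s) x‖ :=
        norm_pos_iff.2 (sub_ne_zero.2 (rad_ne_one h1).symm)
      rw [norm_div, norm_mul, Complex.norm_natCast, Complex.norm_natCast]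
      gcongr
    -- The trivial bound suffices: $q_s^2/2\le\frac89M_{2s}^2\le\frac29M_{2s}M_{2s+2}$.
    have e2 : ‖rad m (2 * s + 2) x * dirichletSum m (bigQ m s) x‖ ≤
        (bigM m (2 * s) : ℝ) * bigM m (2 * s + 2) / 4 := by
      rw [norm_mul, norm_rad, one_mul]
      refine (norm_dirichletSum_le _ _).trans ?_
      have q1 : (3 : ℝ) * bigQ m s ≤ 4 * bigM m (2 * s) := by exact_mod_cast three_mul_bigQ_le hm s
      have q2 : (4 : ℝ) * bigM m (2 * s) ≤ bigM m (2 * s + 2) := by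
        exact_mod_cast four_mul_bigM_le hm (2 * s)
      have q3 : (0 : ℝ) ≤ bigQ m s := by positivity
      have q4 : (0 : ℝ) < bigM m (2 * s) := by exact_mod_cast hM
      nlinarith [mul_le_mul q1 q1 (by positivity) (by positivity)]
    have e3 := norm_sub_le_norm_add
      (bigM m (2 * s) * bigM m (2 * s + 2) / (1 - rad m (2 * s) x) : ℂ)
      (rad m (2 * s + 2) x * dirichletSum m (bigQ m s) x)
    linarith
  | succ n hn ih =>
    have hn' : s + 1 ≤ n := hn
    rw [dirichletSum_bigQ_succ hm, dirichlet_bigM_of_ne hm (by omega) h1,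
      dirichletSum_bigM_eq_zero hm (k := 2 * s) (l := 2 * s + 2) (by omega) (by omega) h1 h3,
      mul_zero, add_zero, zero_add, norm_mul, norm_rad, one_mul]
    exact ih

end Kernels

/-! ### Measure of intervals and the martingale $(D_{M_n})_n$. -/

section Haar

variable {m : ℕ → ℕ}

instance isProbabilityMeasure_haar [∀ i, NeZero (m i)] : IsProbabilityMeasure (haar m) := by
  unfold haar; infer_instance

theorem haar_cyl [∀ i, NeZero (m i)] (n : ℕ) (x : VGroup m) :
    haar m (cyl m n x) = (bigM m n : ℝ≥0∞)⁻¹ := by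
  have h : cyl m n x = Set.pi (Finset.range n : Finset ℕ) fun i => {x i} := by
    ext y; simp [cyl, Set.mem_pi]
  rw [h, haar, Measure.infinitePi_pi _ fun _ _ => measurableSet_singleton _]
  have h2 : ∀ i, ProbabilityTheory.uniformOn (Set.univ : Set (ZMod (m i))) {x i} =
      (m i : ℝ≥0∞)⁻¹ := fun i => by
    rw [ProbabilityTheory.uniformOn_univ, Measure.count_singleton, ZMod.card, one_div]
  rw [Finset.prod_congr rfl fun i _ => h2 i]
  induction n with
  | zero => simp [bigM]
  | succ n ih =>
    have h' : cyl m n x = Set.pi (Finset.range n : Finset ℕ) fun i => {x i} := by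
      ext y; simp [cyl, Set.mem_pi]
    rw [Finset.prod_range_succ, ih h', bigM_succ, Nat.cast_mul, mul_comm,
      ENNReal.mul_inv (Or.inr (by simp)) (Or.inl (by simp))]

theorem haar_real_cyl [∀ i, NeZero (m i)] (n : ℕ) (x : VGroup m) :
    (haar m).real (cyl m n x) = (bigM m n : ℝ)⁻¹ := by
  rw [Measure.real, haar_cyl]; simp

/-- Sets not separating points with equal first $n$ coordinates form a $\sigma$-algebra containing
the generators. -/
theorem mem_iff_of_measurableSet_filt {n : ℕ} {s : Set (VGroup m)}
    (hs : MeasurableSet[filt m n] s) {x y : VGroup m} (h : ∀ i < n, x i = y i) :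
    x ∈ s ↔ y ∈ s := by
  induction s, hs using MeasurableSpace.generateFrom_induction with
  | hC t ht _ =>
    obtain ⟨z, rfl⟩ := ht
    exact ⟨fun hx i hi => (h i hi).symm.trans (hx i hi), fun hy i hi => (h i hi).trans (hy i hi)⟩
  | empty => rfl
  | compl t _ ih => exact not_congr ih
  | iUnion t _ ih => simp only [Set.mem_iUnion]; exact exists_congr ih

theorem measurable_rad (k : ℕ) : Measurable (rad m k) := by
  have : rad m k = (fun z : ZMod (m k) => Complex.exp (2 * Real.pi * Complex.I *
    (z.val : ℂ) / (m k : ℂ))) ∘ fun x : VGroup m => x k := rfl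
  rw [this]
  exact (measurable_from_top).comp (measurable_pi_apply k)

theorem measurable_psi (n : ℕ) : Measurable (psi m n) :=
  Finset.measurable_fun_prod _ fun k _ => (measurable_rad k).pow_const _

theorem measurableSet_filt_cyl {n k : ℕ} (h : n ≤ k) (x : VGroup m) :
    MeasurableSet[filt m k] (cyl m n x) := measurableSet_cyl_of_le m h x

theorem stronglyMeasurable_dirichlet_bigM [∀ i, NeZero (m i)] (hm : ∀ i, 2 ≤ m i) {n k : ℕ}
    (h : n ≤ k) : StronglyMeasurable[filt m k] (dirichlet m (bigM m n)) := by
  rw [dirichlet_bigM hm]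
  exact stronglyMeasurable_const.indicator (measurableSet_filt_cyl h 0)

theorem integrable_dirichlet_bigM [∀ i, NeZero (m i)] (hm : ∀ i, 2 ≤ m i) (n : ℕ) :
    Integrable (dirichlet m (bigM m n)) (haar m) := by
  rw [dirichlet_bigM hm]
  exact (integrable_const _).indicator (measurableSet_cyl m n 0)

/-- $D_{M_n}$ is the normalized indicator of $I_n(0)$, which an $\mathcal F_k$-set contains or
misses. The value does not depend on $n\ge k$, and this is the martingale property. -/
theorem setIntegral_dirichlet_bigM [∀ i, NeZero (m i)] (hm : ∀ i, 2 ≤ m i) {n k : ℕ}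
    (h : k ≤ n) {s : Set (VGroup m)} (hs : MeasurableSet[filt m k] s) :
    ∫ x in s, dirichlet m (bigM m n) x ∂(haar m) = s.indicator 1 (0 : VGroup m) := by
  rw [dirichlet_bigM hm, setIntegral_indicator (measurableSet_cyl m n 0), setIntegral_const]
  have hM : (bigM m n : ℂ) ≠ 0 := by exact_mod_cast (bigM_pos hm n).ne'
  by_cases h0 : (0 : VGroup m) ∈ s
  · have : s ∩ cyl m n 0 = cyl m n 0 := by
      refine Set.inter_eq_right.2 fun y hy => ?_
      exact (mem_iff_of_measurableSet_filt hs fun i hi => hy i (hi.trans_le h)).2 h0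
    rw [this, haar_real_cyl, Set.indicator_of_mem h0]
    simp [hM]
  · have : s ∩ cyl m n 0 = ∅ := by
      refine Set.eq_empty_of_forall_notMem fun y hy => h0 ?_
      exact (mem_iff_of_measurableSet_filt hs fun i hi => hy.2 i (hi.trans_le h)).1 hy.1
    rw [this, Set.indicator_of_notMem h0]
    simp

theorem martingale_dirichlet_bigM [∀ i, NeZero (m i)] (hm : ∀ i, 2 ≤ m i) :
    Martingale (fun n => dirichlet m (bigM m n)) (filt m) (haar m) := by
  refine martingale_nat (fun n => stronglyMeasurable_dirichlet_bigM hm le_rfl)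
    (integrable_dirichlet_bigM hm) fun n => ?_
  refine ae_eq_condExp_of_forall_setIntegral_eq _ (integrable_dirichlet_bigM hm _)
    (fun s _ _ => (integrable_dirichlet_bigM hm n).integrableOn) (fun s hs _ => ?_)
    (stronglyMeasurable_dirichlet_bigM hm le_rfl).aestronglyMeasurable
  rw [setIntegral_dirichlet_bigM hm le_rfl hs, setIntegral_dirichlet_bigM hm n.le_succ hs]

end Haar

/-! ### The example is a martingale in $H_{1/2}$. -/

section Example

variable {m α : ℕ → ℕ}

theorem integrable_exampleAtom [∀ i, NeZero (m i)] (hm : ∀ i, 2 ≤ m i) (α : ℕ → ℕ) (k : ℕ) :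
    Integrable (exampleAtom m α k) (haar m) :=
  ((integrable_dirichlet_bigM hm _).sub (integrable_dirichlet_bigM hm _)).const_mul _

theorem integrable_exampleMartingale [∀ i, NeZero (m i)] (hm : ∀ i, 2 ≤ m i) (α : ℕ → ℕ) (n : ℕ) :
    Integrable (exampleMartingale m α n) (haar m) :=
  integrable_finsetSum _ fun k _ => (integrable_exampleAtom hm α k).const_mul _

theorem condExp_exampleAtom [∀ i, NeZero (m i)] (hm : ∀ i, 2 ≤ m i) (α : ℕ → ℕ) (k : ℕ) :
    (haar m)[exampleAtom m α k | filt m (2 * α k)] =ᵐ[haar m] 0 := by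
  have h1 : exampleAtom m α k = ((bigM m (2 * α k) : ℂ) / (supM m : ℂ)) •
    (dirichlet m (bigM m (2 * α k + 1)) - dirichlet m (bigM m (2 * α k))) := rfl
  rw [h1]
  refine (condExp_smul _ _ _).trans ?_
  have h2 := (martingale_dirichlet_bigM hm).2 _ _ (Nat.le_succ (2 * α k))
  have h3 := (martingale_dirichlet_bigM hm).2 _ _ (le_refl (2 * α k))
  have h4 := condExp_sub (integrable_dirichlet_bigM hm (2 * α k + 1))
    (integrable_dirichlet_bigM hm (2 * α k)) (filt m (2 * α k))
  filter_upwards [h2, h3, h4] with x h2 h3 h4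
  simp only [Nat.succ_eq_add_one] at h2
  rw [Pi.smul_apply, h4, Pi.sub_apply, h2, h3]
  simp

theorem exampleMartingale_succ (hα : StrictMono α) (n : ℕ) :
    exampleMartingale m α (n + 1) = exampleMartingale m α n +
      ∑ k ∈ Finset.range (n + 1) with 2 * α k = n,
        (fun x => (1 / (α k : ℂ)) * exampleAtom m α k x) := by
  ext x
  rw [Pi.add_apply, Finset.sum_apply, exampleMartingale, exampleMartingale,
    ← Finset.sum_union]
  · refine Finset.sum_congr ?_ fun _ _ => rfl
    ext k
    have := hα.le_apply (x := k)
    simp only [Finset.mem_filter, Finset.mem_range, Finset.mem_union]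
    omega
  · refine Finset.disjoint_left.2 fun k hk hk' => ?_
    simp only [Finset.mem_filter, Finset.mem_range] at hk hk'
    omega

theorem martingale_exampleMartingale [∀ i, NeZero (m i)] (hm : ∀ i, 2 ≤ m i)
    (hα : StrictMono α) : Martingale (exampleMartingale m α) (filt m) (haar m) := by
  have hadp : StronglyAdapted (filt m) (exampleMartingale m α) := fun n => by
    refine Finset.stronglyMeasurable_fun_sum _ fun k hk => ?_
    simp only [Finset.mem_filter, Finset.mem_range] at hk
    refine StronglyMeasurable.const_mul (StronglyMeasurable.const_mul ?_ _) _
    exact (stronglyMeasurable_dirichlet_bigM hm (by omega)).sub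
      (stronglyMeasurable_dirichlet_bigM hm (by omega))
  have hint := integrable_exampleMartingale hm α
  refine martingale_nat hadp hint fun n => ?_
  rw [exampleMartingale_succ hα]
  have hint' : ∀ k, Integrable (fun x => (1 / (α k : ℂ)) * exampleAtom m α k x) (haar m) :=
    fun k => (integrable_exampleAtom hm α k).const_mul _
  have h1 := condExp_add (hint n) (integrable_finsetSum' (Finset.range (n + 1) |>.filter
    fun k => 2 * α k = n) fun k _ => hint' k) (filt m n)
  have h2 := condExp_finsetSum (s := Finset.range (n + 1) |>.filter fun k => 2 * α k = n)
    (fun k _ => hint' k) (filt m n)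
  have h3 : ∀ k ∈ (Finset.range (n + 1) |>.filter fun k => 2 * α k = n),
      (haar m)[fun x => (1 / (α k : ℂ)) * exampleAtom m α k x | filt m n] =ᵐ[haar m] 0 := by
    intro k hk
    have hk' : 2 * α k = n := (Finset.mem_filter.1 hk).2
    have h4 : (fun x => (1 / (α k : ℂ)) * exampleAtom m α k x) =
      (1 / (α k : ℂ)) • exampleAtom m α k := rfl
    rw [h4]
    refine (condExp_smul _ _ _).trans ?_
    have h5 := condExp_exampleAtom hm α k
    rw [hk'] at h5
    filter_upwards [h5] with x h5
    rw [Pi.smul_apply, h5]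
    simp
  rw [condExp_of_stronglyMeasurable ((filt m).le n) (hadp n) (hint n)] at h1
  have h6 := (ae_ball_iff (Finset.countable_toSet _)).2 h3
  filter_upwards [h1, h2, h6] with x h1 h2 h6
  rw [h1, Pi.add_apply, h2, Finset.sum_apply, Finset.sum_eq_zero fun k hk => h6 k hk, add_zero]

theorem enorm_exampleAtom_le [∀ i, NeZero (m i)] (hm : ∀ i, 2 ≤ m i)
    (hbdd : BddAbove (Set.range m)) (α : ℕ → ℕ) (k : ℕ) (x : VGroup m) :
    ‖exampleAtom m α k x‖ₑ ≤
      (cyl m (2 * α k) 0).indicator (fun _ => (bigM m (2 * α k) : ℝ≥0∞) ^ 2) x := by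
  by_cases hx : x ∈ cyl m (2 * α k) 0
  · rw [Set.indicator_of_mem hx]
    have hM : (0 : ℝ) < bigM m (2 * α k) := by exact_mod_cast bigM_pos hm _
    have hle : m (2 * α k) ≤ supM m := le_ciSup hbdd _
    have hsup : (0 : ℝ) < supM m := by
      have := hm (2 * α k); exact_mod_cast (by omega : 0 < supM m)
    have h0 : ‖exampleAtom m α k x‖ ≤ (bigM m (2 * α k) : ℝ) ^ 2 := by
      rw [exampleAtom, norm_mul, norm_div, Complex.norm_natCast, Complex.norm_natCast,
        dirichlet_bigM_of_mem hm hx le_rfl]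
      -- The factor $M$ lost here is what the normalization $1/M$ of the atom absorbs.
      have h1 : ‖dirichlet m (bigM m (2 * α k + 1)) x - (bigM m (2 * α k) : ℂ)‖ ≤
          supM m * bigM m (2 * α k) := by
        have hsucc : (bigM m (2 * α k + 1) : ℝ) ≤ supM m * bigM m (2 * α k) := by
          rw [bigM_succ]; exact_mod_cast Nat.mul_le_mul_right _ hle
        by_cases h : x ∈ cyl m (2 * α k + 1) 0
        · rw [dirichlet_bigM hm, Set.indicator_of_mem h, ← Nat.cast_sub
            ((bigM_strictMono hm).monotone (Nat.le_succ _)), Complex.norm_natCast]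
          refine le_trans ?_ hsucc
          exact_mod_cast Nat.sub_le _ _
        · rw [dirichlet_bigM hm, Set.indicator_of_notMem h, zero_sub, norm_neg,
            Complex.norm_natCast]
          refine le_trans ?_ hsucc
          exact_mod_cast (bigM_strictMono hm).monotone (Nat.le_succ _)
      calc (bigM m (2 * α k) : ℝ) / supM m *
            ‖dirichlet m (bigM m (2 * α k + 1)) x - (bigM m (2 * α k) : ℂ)‖
          ≤ (bigM m (2 * α k) : ℝ) / supM m * (supM m * bigM m (2 * α k)) := by gcongr
        _ = (bigM m (2 * α k) : ℝ) ^ 2 := by field_simp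
    rw [← ofReal_norm]
    refine (ENNReal.ofReal_le_ofReal h0).trans ?_
    rw [ENNReal.ofReal_pow hM.le, ENNReal.ofReal_natCast]
  · have h1 : x ∉ cyl m (2 * α k + 1) 0 := fun h => hx fun i hi => h i (by omega)
    rw [exampleAtom, dirichlet_bigM hm, dirichlet_bigM hm, Set.indicator_of_notMem hx,
      Set.indicator_of_notMem h1]
    simp

theorem rpow_sum_le_sum_rpow_of_le_one {ι : Type*} (s : Finset ι) (f : ι → ℝ≥0∞) {p : ℝ}
    (hp : 0 < p) (hp1 : p ≤ 1) : (∑ i ∈ s, f i) ^ p ≤ ∑ i ∈ s, f i ^ p := by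
  classical
  induction s using Finset.induction_on with
  | empty => simp [ENNReal.zero_rpow_of_pos hp]
  | insert a s ha ih =>
    rw [Finset.sum_insert ha, Finset.sum_insert ha]
    exact (ENNReal.rpow_add_le_add_rpow _ _ hp.le hp1).trans (by gcongr)

theorem memHardy_exampleMartingale [∀ i, NeZero (m i)] (hm : ∀ i, 2 ≤ m i)
    (hbdd : BddAbove (Set.range m)) (hα : FastGrowing m α) :
    MemHardy m (1 / 2) (exampleMartingale m α) := by
  refine ⟨martingale_exampleMartingale hm hα.strictMono, ?_⟩
  have htoReal : (1 / 2 : ℝ≥0∞).toReal = 1 / 2 := by simp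
  rw [eLpNorm_lt_top_iff_lintegral_rpow_enorm_lt_top (by simp) (by simp), htoReal]
  set g : ℕ → VGroup m → ℝ≥0∞ := fun k => (cyl m (2 * α k) 0).indicator fun _ =>
    ENNReal.ofReal ((α k : ℝ) ^ (-(1 / 2) : ℝ)) * bigM m (2 * α k) with hg
  have hatom : ∀ k x, ‖(1 / (α k : ℂ)) * exampleAtom m α k x‖ₑ ^ (1 / 2 : ℝ) ≤ g k x := by
    intro k x
    have hk : (0 : ℝ) < α k := by exact_mod_cast hα.pos k
    have h1 : ‖(1 / (α k : ℂ))‖ₑ = ENNReal.ofReal ((α k : ℝ) ^ (-1 : ℝ)) := by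
      rw [← ofReal_norm, Real.rpow_neg_one]; simp
    rw [enorm_mul, ENNReal.mul_rpow_of_nonneg _ _ (by norm_num), h1,
      ENNReal.ofReal_rpow_of_nonneg (by positivity) (by norm_num), ← Real.rpow_mul hk.le]
    have h2 := enorm_exampleAtom_le hm hbdd α k x
    by_cases hx : x ∈ cyl m (2 * α k) 0
    · rw [Set.indicator_of_mem hx] at h2
      rw [hg]
      simp only
      rw [Set.indicator_of_mem hx]
      have h3 := ENNReal.rpow_le_rpow h2 (by norm_num : (0 : ℝ) ≤ 1 / 2)
      rw [← ENNReal.rpow_natCast, ← ENNReal.rpow_mul] at h3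
      norm_num at h3 ⊢
      gcongr
    · rw [Set.indicator_of_notMem hx] at h2
      rw [le_antisymm h2 zero_le]
      simp
  have hmax : ∀ x, ‖maximal m (exampleMartingale m α) x‖ₑ ^ (1 / 2 : ℝ) ≤ ∑' k, g k x := by
    intro x
    rw [enorm_eq_self]
    -- Squaring the target lets the square-root estimate be applied to each $f^{(n)}$ separately,
    -- before the supremum.
    have : maximal m (exampleMartingale m α) x ≤ (∑' k, g k x) ^ (2 : ℝ) := by
      refine iSup_le fun n => ?_
      rw [← ENNReal.rpow_le_rpow_iff (z := 1 / 2) (by norm_num), ← ENNReal.rpow_mul]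
      norm_num
      refine (ENNReal.rpow_le_rpow (enorm_sum_le _ _) (by norm_num)).trans ?_
      refine (rpow_sum_le_sum_rpow_of_le_one _ _ (by norm_num) (by norm_num)).trans ?_
      refine (Finset.sum_le_sum fun k _ => ?_).trans (ENNReal.sum_le_tsum _)
      exact hatom k x
    refine (ENNReal.rpow_le_rpow this (by norm_num : (0 : ℝ) ≤ 1 / 2)).trans ?_
    rw [← ENNReal.rpow_mul]
    norm_num
  refine (lintegral_mono hmax).trans_lt ?_
  rw [lintegral_tsum fun k => (measurable_const.indicator (measurableSet_cyl m _ 0)).aemeasurable]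
  have hgint : ∀ k, ∫⁻ x, g k x ∂(haar m) = ENNReal.ofReal ((α k : ℝ) ^ (-(1 / 2) : ℝ)) := by
    intro k
    rw [hg]
    simp only
    rw [lintegral_indicator_const (measurableSet_cyl m _ 0), haar_cyl, mul_assoc,
      ENNReal.mul_inv_cancel (by exact_mod_cast (bigM_pos hm _).ne') (by simp), mul_one]
  rw [tsum_congr hgint, ← ENNReal.ofReal_tsum_of_nonneg (fun k => by positivity) hα.summable]
  exact ENNReal.ofReal_lt_top

end Example

/-! ### Fourier coefficients of the example and its Fejér means of order $q_{\alpha_k}$. -/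

section Coefficients

variable {m α : ℕ → ℕ}

theorem integral_haar_prod [∀ i, NeZero (m i)] (N : ℕ) (h : ∀ k, ZMod (m k) → ℂ) :
    ∫ x, ∏ k ∈ Finset.range N, h k (x k) ∂(haar m) = ∏ k ∈ Finset.range N,
      ∫ z, h k z ∂(ProbabilityTheory.uniformOn (Set.univ : Set (ZMod (m k)))) := by
  have h1 : ∀ x : VGroup m, ∏ k ∈ Finset.range N, h k (x k) =
      (fun y : ∀ k : Finset.range N, ZMod (m k) => ∏ k : Finset.range N, h k (y k))
        ((Finset.range N).restrict x) := fun x => by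
    simp only [Finset.restrict]
    exact (Finset.prod_coe_sort (Finset.range N) fun k => h k (x k)).symm
  refine (integral_congr_ae (ae_of_all _ h1)).trans ?_
  have h2 : AEStronglyMeasurable
      (fun y : ∀ k : Finset.range N, ZMod (m k) => ∏ k : Finset.range N, h k (y k))
      (Measure.pi fun k : Finset.range N =>
        ProbabilityTheory.uniformOn (Set.univ : Set (ZMod (m k)))) :=
    (Finset.measurable_fun_prod _ fun k _ =>
      measurable_from_top.comp (measurable_pi_apply k)).aestronglyMeasurable
  refine (integral_restrict_infinitePi
    (μ := fun k => ProbabilityTheory.uniformOn (Set.univ : Set (ZMod (m k)))) h2).trans ?_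
  rw [integral_fintype_prod_eq_prod (𝕜 := ℂ) fun (k : Finset.range N) z => h k z]
  exact Finset.prod_coe_sort (Finset.range N) fun k =>
    ∫ z, h k z ∂(ProbabilityTheory.uniformOn (Set.univ : Set (ZMod (m k))))

theorem integral_conj_stdAddChar_pow {N : ℕ} [NeZero N] {d : ℕ} (h0 : 0 < d) (h1 : d < N) :
    ∫ z, (starRingEnd ℂ) (ZMod.stdAddChar (N := N) z ^ d)
      ∂(ProbabilityTheory.uniformOn (Set.univ : Set (ZMod N))) = 0 := by
  rw [integral_conj, integral_fintype .of_finite]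
  have h2 : ∀ z : ZMod N, (ProbabilityTheory.uniformOn (Set.univ : Set (ZMod N))).real {z} =
      (N : ℝ)⁻¹ := fun z => by
    rw [Measure.real, ProbabilityTheory.uniformOn_univ, Measure.count_singleton, ZMod.card]
    simp
  have h3 : (d : ZMod N) ≠ 0 := fun h =>
    Nat.not_dvd_of_pos_of_lt h0 h1 ((ZMod.natCast_eq_zero_iff d N).1 h)
  have h4 := AddChar.sum_mulShift (d : ZMod N) (ZMod.isPrimitive_stdAddChar N)
  rw [if_neg h3] at h4
  have h5 : ∀ z : ZMod N, ZMod.stdAddChar z ^ d = ZMod.stdAddChar (z * (d : ZMod N)) := fun z => by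
    rw [← AddChar.map_nsmul_eq_pow, nsmul_eq_mul, mul_comm]
  simp_rw [h2, h5]
  rw [← Finset.smul_sum, h4]
  simp

/-- The leading digit of $i$ sits at some $t\ge n$, a coordinate the indicator ignores; by
independence a nontrivial character of $\mathbb Z_{m_t}$ factors out and integrates to zero. -/
theorem integral_indicator_mul_conj_psi [∀ i, NeZero (m i)] (hm : ∀ i, 2 ≤ m i) {n i : ℕ}
    (hi : bigM m n ≤ i) :
    ∫ x, (cyl m n 0).indicator 1 x * (starRingEnd ℂ) (psi m i x) ∂(haar m) = 0 := by
  obtain ⟨t, ht, ht1⟩ : ∃ t, bigM m t ≤ i ∧ i < bigM m (t + 1) := by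
    have hex : ∃ t, i < bigM m t := ⟨i, lt_bigM_self hm i⟩
    classical
    rcases hfind : Nat.find hex with _ | t
    · have h := Nat.find_spec hex
      rw [hfind] at h
      have := (bigM_strictMono hm).monotone (Nat.zero_le n)
      omega
    · refine ⟨t, not_lt.1 (Nat.find_min hex (by omega)), ?_⟩
      have h := Nat.find_spec hex
      rwa [hfind] at h
  have hnt : n ≤ t := by
    by_contra h
    have := (bigM_strictMono hm).monotone (show t + 1 ≤ n by omega)
    omega
  have hMt := bigM_pos hm t
  have hdig : digit m i t = i / bigM m t :=
    Nat.mod_eq_of_lt ((Nat.div_lt_iff_lt_mul hMt).2 ht1)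
  have hd0 : 0 < digit m i t := by rw [hdig]; exact Nat.div_pos ht hMt
  have hd1 : digit m i t < m t := Nat.mod_lt _ (by have := hm t; omega)
  classical
  let h : ∀ k, ZMod (m k) → ℂ := fun k z => (if k < n ∧ z ≠ 0 then (0 : ℂ) else 1) *
    (starRingEnd ℂ) (ZMod.stdAddChar z ^ digit m i k)
  have hprod : ∀ x : VGroup m, (cyl m n 0).indicator 1 x * (starRingEnd ℂ) (psi m i x) =
      ∏ k ∈ Finset.range (t + 1), h k (x k) := fun x => by
    simp only [h, Finset.prod_mul_distrib]
    rw [psi_eq_prod hm ht1, map_prod]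
    simp_rw [rad_eq_stdAddChar]
    congr 1
    by_cases hx : x ∈ cyl m n 0
    · rw [Set.indicator_of_mem hx, Finset.prod_eq_one fun k _ => if_neg fun h => h.2 (hx k h.1)]
      rfl
    · rw [Set.indicator_of_notMem hx]
      simp only [cyl, Set.mem_ofPred_eq, not_forall] at hx
      obtain ⟨k, hk, hk'⟩ := hx
      exact (Finset.prod_eq_zero (Finset.mem_range.2 (by omega : k < t + 1))
        (by rw [if_pos ⟨hk, hk'⟩])).symm
  refine (integral_congr_ae (ae_of_all _ hprod)).trans ((integral_haar_prod (t + 1) h).trans ?_)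
  refine Finset.prod_eq_zero (Finset.mem_range.2 t.lt_succ_self) ?_
  have hnt' : ¬ t < n := by omega
  simp only [h, hnt', false_and, if_false, one_mul]
  exact integral_conj_stdAddChar_pow hd0 hd1

theorem integral_dirichlet_mul_conj_psi [∀ i, NeZero (m i)] (hm : ∀ i, 2 ≤ m i) (n i : ℕ) :
    ∫ x, dirichlet m (bigM m n) x * (starRingEnd ℂ) (psi m i x) ∂(haar m) =
      if i < bigM m n then 1 else 0 := by
  split_ifs with h
  · have h1 : ∀ x, dirichlet m (bigM m n) x * (starRingEnd ℂ) (psi m i x) =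
        dirichlet m (bigM m n) x := fun x => by
      by_cases hx : x ∈ cyl m n 0
      · rw [psi_eq_one hm h hx, map_one, mul_one]
      · rw [dirichlet_bigM hm, Set.indicator_of_notMem hx, zero_mul]
    simp_rw [h1]
    have h2 := setIntegral_dirichlet_bigM hm (Nat.zero_le n) (MeasurableSet.univ (m := filt m 0))
    rw [setIntegral_univ] at h2
    rw [h2]
    simp
  · have h1 : ∀ x, dirichlet m (bigM m n) x * (starRingEnd ℂ) (psi m i x) =
        (bigM m n : ℂ) * ((cyl m n 0).indicator 1 x * (starRingEnd ℂ) (psi m i x)) := fun x => by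
      rw [dirichlet_bigM hm, ← mul_assoc]
      congr 1
      by_cases hx : x ∈ cyl m n 0
      · simp [Set.indicator_of_mem hx]
      · simp [Set.indicator_of_notMem hx]
    simp_rw [h1]
    rw [integral_const_mul, integral_indicator_mul_conj_psi hm (not_lt.1 h), mul_zero]

theorem integrable_mul_conj_psi [∀ i, NeZero (m i)] {f : VGroup m → ℂ}
    (hf : Integrable f (haar m)) (i : ℕ) :
    Integrable (fun x => f x * (starRingEnd ℂ) (psi m i x)) (haar m) := by
  refine hf.mul_bdd (c := 1) ?_ (ae_of_all _ fun x => ?_)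
  · exact (Complex.continuous_conj.measurable.comp (measurable_psi i)).aestronglyMeasurable
  · rw [RCLike.norm_conj, norm_psi]

theorem integral_exampleAtom_mul_conj_psi [∀ i, NeZero (m i)] (hm : ∀ i, 2 ≤ m i) (α : ℕ → ℕ)
    (k i : ℕ) : ∫ x, exampleAtom m α k x * (starRingEnd ℂ) (psi m i x) ∂(haar m) =
      if i ∈ Finset.Ico (bigM m (2 * α k)) (bigM m (2 * α k + 1)) then
        (bigM m (2 * α k) : ℂ) / (supM m : ℂ) else 0 := by
  simp_rw [exampleAtom, mul_assoc, sub_mul]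
  rw [integral_const_mul, integral_sub (integrable_mul_conj_psi (integrable_dirichlet_bigM hm _) i)
    (integrable_mul_conj_psi (integrable_dirichlet_bigM hm _) i),
    integral_dirichlet_mul_conj_psi hm, integral_dirichlet_mul_conj_psi hm]
  have := (bigM_strictMono hm) (Nat.lt_add_one (2 * α k))
  simp only [Finset.mem_Ico]
  by_cases h1 : i < bigM m (2 * α k)
  · rw [if_pos h1, if_pos (by omega), if_neg (by omega), sub_self, mul_zero]
  · by_cases h2 : i < bigM m (2 * α k + 1)
    · rw [if_neg h1, if_pos h2, if_pos (by omega), sub_zero, mul_one]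
    · rw [if_neg h1, if_neg h2, if_neg (by omega), sub_self, mul_zero]

/-- The common value of the coefficients of the example in the block `[M_{2 α_k}, M_{2 α_k + 1})`. -/
noncomputable def blockCoeff (m α : ℕ → ℕ) (k : ℕ) : ℂ :=
  (1 / (α k : ℂ)) * ((bigM m (2 * α k) : ℂ) / (supM m : ℂ))

theorem coeff_exampleMartingale [∀ i, NeZero (m i)] (hm : ∀ i, 2 ≤ m i) (hα : StrictMono α)
    {K i : ℕ} (hi : i < bigM m (2 * α K)) :
    coeff m (exampleMartingale m α) i = ∑ k ∈ Finset.range K,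
      if i ∈ Finset.Ico (bigM m (2 * α k)) (bigM m (2 * α k + 1)) then blockCoeff m α k else 0 := by
  refine Tendsto.limUnder_eq (tendsto_const_nhds.congr' ?_)
  filter_upwards [eventually_ge_atTop (2 * α K)] with A hA
  simp_rw [exampleMartingale, Finset.sum_mul, mul_assoc]
  rw [integral_finsetSum _ fun k _ =>
    (integrable_mul_conj_psi (integrable_exampleAtom hm α k) i).const_mul _]
  simp_rw [integral_const_mul, integral_exampleAtom_mul_conj_psi hm, mul_ite, mul_zero]
  refine Finset.sum_subset (fun k hk => ?_) fun k _ hk => if_neg fun h => hk ?_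
  · have h1 : α k < α K := hα (Finset.mem_range.1 hk)
    have h2 := hα.le_apply (x := k)
    exact Finset.mem_filter.2 ⟨Finset.mem_range.2 (by omega), by omega⟩
  · have h1 : bigM m (2 * α k) < bigM m (2 * α K) := (Finset.mem_Ico.1 h).1.trans_lt hi
    have h2 := (bigM_strictMono hm).lt_iff_lt.1 h1
    exact Finset.mem_range.2 (hα.lt_iff_lt.1 (by omega))

theorem partialSum_exampleMartingale [∀ i, NeZero (m i)] (hm : ∀ i, 2 ≤ m i) (hα : StrictMono α)
    {K n : ℕ} (hn : n ≤ bigM m (2 * α K)) (x : VGroup m) :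
    partialSum m (exampleMartingale m α) n x = ∑ k ∈ Finset.range K, blockCoeff m α k *
      ∑ i ∈ Finset.range n with i ∈ Finset.Ico (bigM m (2 * α k)) (bigM m (2 * α k + 1)),
        psi m i x := by
  rw [partialSum, Finset.sum_congr rfl fun i hi => by
    rw [coeff_exampleMartingale hm hα ((Finset.mem_range.1 hi).trans_le hn), Finset.sum_mul],
    Finset.sum_comm]
  refine Finset.sum_congr rfl fun k _ => ?_
  rw [Finset.mul_sum, Finset.sum_filter]
  exact Finset.sum_congr rfl fun i _ => by split_ifs <;> simp

theorem norm_blockCoeff (m α : ℕ → ℕ) (k : ℕ) :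
    ‖blockCoeff m α k‖ = (bigM m (2 * α k) : ℝ) / (supM m * α k) := by
  rw [blockCoeff, norm_mul, norm_div, norm_div, norm_one, Complex.norm_natCast,
    Complex.norm_natCast, Complex.norm_natCast]
  ring

theorem supM_pos (hm : ∀ i, 2 ≤ m i) (hbdd : BddAbove (Set.range m)) : (0 : ℝ) < supM m := by
  have h1 : m 0 ≤ supM m := le_ciSup hbdd 0
  have h2 := hm 0
  exact_mod_cast (by omega : 0 < supM m)

theorem bigM_succ_le (hbdd : BddAbove (Set.range m)) (n : ℕ) :
    (bigM m (n + 1) : ℝ) ≤ supM m * bigM m n := by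
  rw [bigM_succ]
  exact_mod_cast Nat.mul_le_mul_right _ (le_ciSup hbdd n)

/-- Controls the older blocks by counting: at most $M\,M_{2\alpha_k}$ characters in each, uniformly
in the order of the partial sum. -/
theorem norm_sum_blockCoeff_le [∀ i, NeZero (m i)] (hm : ∀ i, 2 ≤ m i)
    (hbdd : BddAbove (Set.range m)) (α : ℕ → ℕ) (K n : ℕ) (x : VGroup m) :
    ‖∑ k ∈ Finset.range K, blockCoeff m α k *
      ∑ i ∈ Finset.range n with i ∈ Finset.Ico (bigM m (2 * α k)) (bigM m (2 * α k + 1)),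
        psi m i x‖ ≤ ∑ k ∈ Finset.range K, (bigM m (2 * α k) : ℝ) ^ 2 / α k := by
  refine (norm_sum_le _ _).trans (Finset.sum_le_sum fun k _ => ?_)
  have hsup := supM_pos hm hbdd
  rw [norm_mul, norm_blockCoeff]
  have h1 : ‖∑ i ∈ Finset.range n with i ∈ Finset.Ico (bigM m (2 * α k)) (bigM m (2 * α k + 1)),
      psi m i x‖ ≤ supM m * bigM m (2 * α k) := by
    refine le_trans ?_ (bigM_succ_le hbdd _)
    refine (norm_sum_le _ _).trans ?_
    simp only [norm_psi, Finset.sum_const, nsmul_eq_mul, mul_one]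
    have h2 : (Finset.range n |>.filter fun i =>
        i ∈ Finset.Ico (bigM m (2 * α k)) (bigM m (2 * α k + 1))) ⊆
        Finset.range (bigM m (2 * α k + 1)) := fun i hi =>
      Finset.mem_range.2 (Finset.mem_Ico.1 (Finset.mem_filter.1 hi).2).2
    exact_mod_cast (Finset.card_le_card h2).trans_eq (Finset.card_range _)
  refine (mul_le_mul_of_nonneg_left h1 (by positivity)).trans_eq ?_
  rw [div_mul_eq_mul_div, mul_left_comm, mul_div_mul_left _ _ hsup.ne', sq]

theorem sum_block_psi (hm : ∀ i, 2 ≤ m i) {n l : ℕ} (hl : l ≤ bigM m n) (x : VGroup m) :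
    ∑ i ∈ Finset.range (bigM m n + l) with i ∈ Finset.Ico (bigM m n) (bigM m (n + 1)),
      psi m i x = rad m n x * dirichlet m l x := by
  have h2 := two_mul_bigM_le hm n
  have h1 := dirichlet_mul_add hm (a := 1) (n := n) (hm n) hl x
  rw [one_mul, pow_one] at h1
  have h3 : (Finset.range (bigM m n + l)).filter
      (fun i => i ∈ Finset.Ico (bigM m n) (bigM m (n + 1))) =
        Finset.Ico (bigM m n) (bigM m n + l) := by
    ext i
    simp only [Finset.mem_filter, Finset.mem_range, Finset.mem_Ico]
    omega
  rw [h3, Finset.sum_Ico_eq_sub _ (Nat.le_add_right _ _)]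
  exact sub_eq_of_eq_add' h1

theorem fejer_bigQ [∀ i, NeZero (m i)] (hm : ∀ i, 2 ≤ m i) (hα : StrictMono α)
    {k n : ℕ} (hk : α k = n + 1) (x : VGroup m) :
    fejer m (exampleMartingale m α) (bigQ m (n + 1)) x = (1 / (bigQ m (n + 1) : ℂ)) *
      (∑ j ∈ Finset.range (bigQ m (n + 1)), (∑ η ∈ Finset.range k, blockCoeff m α η *
        ∑ i ∈ Finset.range j with i ∈ Finset.Ico (bigM m (2 * α η)) (bigM m (2 * α η + 1)),
          psi m i x) +
        blockCoeff m α k * (rad m (2 * n + 2) x * dirichletSum m (bigQ m n) x)) := by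
  have hq := bigQ_le_bigM hm n
  -- Only blocks $0,\dots,k$ are reached by these partial sums.
  have hle : bigQ m (n + 1) ≤ bigM m (2 * α (k + 1)) := by
    have h1 := two_mul_bigM_le hm (2 * n + 2)
    have h2 : bigM m (2 * n + 2 + 1) ≤ bigM m (2 * α (k + 1)) :=
      (bigM_strictMono hm).monotone (by have := hα (Nat.lt_add_one k); omega)
    rw [bigQ_succ]
    omega
  rw [fejer]
  congr 1
  rw [Finset.sum_congr rfl fun j hj => by
    rw [partialSum_exampleMartingale hm hα ((Finset.mem_range.1 hj).le.trans hle),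
      Finset.sum_range_succ], Finset.sum_add_distrib]
  congr 1
  rw [← Finset.mul_sum, hk, show 2 * (n + 1) = 2 * n + 2 by ring, bigQ_succ, one_mul,
    Finset.sum_range_add]
  congr 1
  rw [Finset.sum_eq_zero, zero_add, dirichletSum, Finset.mul_sum]
  · refine Finset.sum_congr rfl fun l hl => ?_
    exact sum_block_psi hm ((Finset.mem_range.1 hl).le.trans hq) x
  · intro j hj
    rw [Finset.filter_false_of_mem, Finset.sum_empty]
    intro i hi
    simp only [Finset.mem_range, Finset.mem_Ico] at *
    omega

theorem le_norm_fejer_bigQ [∀ i, NeZero (m i)] (hm : ∀ i, 2 ≤ m i)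
    (hbdd : BddAbove (Set.range m)) (hα : FastGrowing m α) {k n s : ℕ} (hk : α (k + 1) = n + 1)
    (hs : s < n) (hs' : n ≤ 2 * s + 1) {x : VGroup m} (hx : x ∈ spike m s) :
    (bigM m (2 * s) : ℝ) * bigM m (2 * s + 2) / (8 * supM m * (n + 1)) ≤
      ‖fejer m (exampleMartingale m α) (bigQ m (n + 1)) x‖ := by
  rw [fejer_bigQ hm hα.strictMono hk]
  set B : ℝ := ∑ η ∈ Finset.range (k + 1), (bigM m (2 * α η) : ℝ) ^ 2 / α η with hB
  set q : ℕ := bigQ m (n + 1) with hq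
  have hsup := supM_pos hm hbdd
  have hqpos : (0 : ℝ) < q := by
    have : 0 < q := by
      have := bigM_pos hm (2 * n + 2)
      rw [hq, bigQ_succ]; omega
    exact_mod_cast this
  have hqle : (3 : ℝ) * q ≤ 4 * bigM m (2 * (n + 1)) := by
    exact_mod_cast three_mul_bigQ_le hm (n + 1)
  -- `sum_lt` bounds $B$ by twice its last term; `lt_next` with its 32 then leaves 16.
  have hBle : B ≤ bigM m (n + 1) / (16 * supM m * (n + 1)) := by
    have h1 := hα.sum_lt k
    have h2 := hα.lt_next k
    rw [hk] at h2
    rw [hB, Finset.sum_range_succ]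
    have h3 : (32 : ℝ) * supM m * bigM m (2 * α k) ^ 2 / α k =
      32 * supM m * (bigM m (2 * α k) ^ 2 / α k) := by ring
    rw [h3] at h2
    push_cast at h2
    rw [le_div_iff₀ (by positivity)]
    rw [lt_div_iff₀ (by positivity)] at h2
    have h4 : (∑ η ∈ Finset.range k, (bigM m (2 * α η) : ℝ) ^ 2 / α η +
        (bigM m (2 * α k) : ℝ) ^ 2 / α k) * (16 * supM m * (n + 1)) ≤
        (2 * ((bigM m (2 * α k) : ℝ) ^ 2 / α k)) * (16 * supM m * (n + 1)) := by
      gcongr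
      linarith
    linarith
  have hold := norm_sum_le_of_le (Finset.range q) fun j _ =>
    norm_sum_blockCoeff_le hm hbdd α (k + 1) j x
  rw [Finset.sum_const, Finset.card_range, nsmul_eq_mul, ← hB] at hold
  set O := ∑ j ∈ Finset.range q, ∑ η ∈ Finset.range (k + 1), blockCoeff m α η *
        ∑ i ∈ Finset.range j with i ∈ Finset.Ico (bigM m (2 * α η)) (bigM m (2 * α η + 1)),
          psi m i x with hO
  have hF := le_norm_dirichletSum_bigQ hm hs hx
  set F := dirichletSum m (bigQ m n) x with hF'
  have htri : ‖blockCoeff m α (k + 1) * (rad m (2 * n + 2) x * F)‖ - ‖O‖ ≤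
      ‖O + blockCoeff m α (k + 1) * (rad m (2 * n + 2) x * F)‖ := by
    rw [add_comm O]
    exact norm_sub_le_norm_add (blockCoeff m α (k + 1) * (rad m (2 * n + 2) x * F)) O
  rw [norm_mul, norm_mul, norm_rad, one_mul, norm_blockCoeff, hk] at htri
  rw [norm_mul, norm_div, norm_one, Complex.norm_natCast, one_div_mul_eq_div, le_div_iff₀ hqpos]
  refine le_trans ?_ htri
  set P : ℝ := (bigM m (2 * s) : ℝ) * bigM m (2 * s + 2) with hP
  -- Here $n\le 2s+1$ is needed: only spikes in the upper half beat the older blocks.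
  have hPle : (bigM m (n + 1) : ℝ) ≤ P := by
    have h1 : bigM m (n + 1) ≤ bigM m (2 * s + 2) := (bigM_strictMono hm).monotone (by omega)
    have h2 := bigM_pos hm (2 * s)
    rw [hP]
    exact_mod_cast h1.trans (Nat.le_mul_of_pos_left _ h2)
  have hmain : 3 * q * P / (16 * supM m * (n + 1)) ≤
      (bigM m (2 * (n + 1)) : ℝ) / (supM m * ((n + 1 : ℕ) : ℝ)) * ‖F‖ := by
    push_cast
    calc 3 * q * P / (16 * supM m * (n + 1))
        ≤ (4 * bigM m (2 * (n + 1))) * P / (16 * supM m * (n + 1)) := by gcongr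
      _ = (bigM m (2 * (n + 1)) : ℝ) / (supM m * (n + 1)) * (P / 4) := by field_simp; ring
      _ ≤ _ := by gcongr
  have hB' : q * B ≤ q * P / (16 * supM m * (n + 1)) := by
    rw [mul_div_assoc]
    exact mul_le_mul_of_nonneg_left (hBle.trans (by gcongr)) hqpos.le
  -- Main term minus older blocks: $\frac3{16}-\frac1{16}=\frac18$.
  have hfin : P / (8 * supM m * (n + 1)) * q =
      3 * q * P / (16 * supM m * (n + 1)) - q * P / (16 * supM m * (n + 1)) := by
    field_simp; ring
  rw [hfin]
  linarith

end Coefficients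

/-! ### Summation over spikes and existence of fast-growing sequences. -/

section Divergence

variable {m α : ℕ → ℕ}

theorem disjoint_spike (hm : ∀ i, 2 ≤ m i) {s t : ℕ} (h : s < t) :
    Disjoint (spike m s) (spike m t) := by
  refine Set.disjoint_left.2 fun x hs ht => ?_
  have h1 : x (2 * s) = if 2 * s = 2 * s ∨ 2 * s = 2 * s + 2 then 1 else 0 := hs _ (by omega)
  have h2 : x (2 * s) = if 2 * s = 2 * t ∨ 2 * s = 2 * t + 2 then 1 else 0 := ht _ (by omega)
  rw [if_pos (by omega)] at h1
  rw [if_neg (by omega)] at h2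
  exact one_ne_zero_zmod hm _ (h1.symm.trans h2)

theorem measurableSet_spike (m : ℕ → ℕ) (s : ℕ) : MeasurableSet (spike m s) :=
  measurableSet_cyl m _ _

/-- The bound is independent of $s$: as $M_{2s+2}\le M^2M_{2s}$, the square root of $M_{2s}M_{2s+2}$
is at least $M_{2s+2}/M$, and the spike has measure at least $1/(M\,M_{2s+2})$. -/
theorem le_setLIntegral_spike [∀ i, NeZero (m i)] (hm : ∀ i, 2 ≤ m i)
    (hbdd : BddAbove (Set.range m)) (hα : FastGrowing m α) {k n s : ℕ} (hk : α (k + 1) = n + 1)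
    (hs : s < n) (hs' : n ≤ 2 * s + 1) :
    ENNReal.ofReal (Real.sqrt (1 / (8 * supM m * (n + 1))) / (supM m) ^ 2) ≤
      ∫⁻ x in spike m s,
        ‖fejer m (exampleMartingale m α) (bigQ m (n + 1)) x‖ₑ ^ (1 / 2 : ℝ) ∂(haar m) := by
  have hsup := supM_pos hm hbdd
  set a := Real.sqrt (1 / (8 * supM m * (n + 1))) with ha
  have ha2 : a ^ 2 = 1 / (8 * supM m * (n + 1)) := Real.sq_sqrt (by positivity)
  have ha0 : 0 ≤ a := Real.sqrt_nonneg _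
  have hM2 : (0 : ℝ) < bigM m (2 * s + 2) := by exact_mod_cast bigM_pos hm _
  have hpt : ∀ x ∈ spike m s, ENNReal.ofReal (bigM m (2 * s + 2) / supM m * a) ≤
      ‖fejer m (exampleMartingale m α) (bigQ m (n + 1)) x‖ₑ ^ (1 / 2 : ℝ) := fun x hx => by
    have h1 := le_norm_fejer_bigQ hm hbdd hα hk hs hs' hx
    have h2 : (bigM m (2 * s + 2) : ℝ) ≤ supM m * (supM m * bigM m (2 * s)) :=
      (bigM_succ_le hbdd (2 * s + 1)).trans (by gcongr; exact bigM_succ_le hbdd (2 * s))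
    have h3 : (bigM m (2 * s + 2) / supM m * a) ^ 2 ≤
        ‖fejer m (exampleMartingale m α) (bigQ m (n + 1)) x‖ := by
      refine le_trans ?_ h1
      rw [mul_pow, ha2, mul_one_div]
      gcongr
      rw [div_pow, div_le_iff₀ (by positivity)]
      nlinarith
    rw [← ofReal_norm, ENNReal.ofReal_rpow_of_nonneg (norm_nonneg _) (by norm_num),
      ← Real.sqrt_eq_rpow]
    exact ENNReal.ofReal_le_ofReal (Real.le_sqrt_of_sq_le h3)
  refine le_trans ?_ (setLIntegral_mono' (measurableSet_spike m s) hpt)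
  rw [setLIntegral_const, spike, haar_cyl]
  have hM3 : (0 : ℝ) < bigM m (2 * s + 3) := by exact_mod_cast bigM_pos hm _
  rw [← ENNReal.ofReal_natCast, ← ENNReal.ofReal_inv_of_pos hM3,
    ← ENNReal.ofReal_mul (by positivity)]
  refine ENNReal.ofReal_le_ofReal ?_
  have h4 : (bigM m (2 * s + 3) : ℝ) ≤ supM m * bigM m (2 * s + 2) := bigM_succ_le hbdd _
  calc a / (supM m : ℝ) ^ 2
      = bigM m (2 * s + 2) / supM m * a * (supM m * bigM m (2 * s + 2) : ℝ)⁻¹ := by field_simp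
    _ ≤ _ := by gcongr

theorem le_eLpNorm_fejer_bigQ [∀ i, NeZero (m i)] (hm : ∀ i, 2 ≤ m i)
    (hbdd : BddAbove (Set.range m)) (hα : FastGrowing m α) (k : ℕ) :
    ENNReal.ofReal (1 / (32 * (supM m : ℝ) ^ 5) * ((α (k + 1) : ℝ) - 2)) ≤
      eLpNorm (fejer m (exampleMartingale m α) (bigQ m (α (k + 1)))) (1 / 2) (haar m) := by
  obtain ⟨n, hn⟩ : ∃ n, α (k + 1) = n + 1 := ⟨α (k + 1) - 1, by have := hα.pos (k + 1); omega⟩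
  have hsup := supM_pos hm hbdd
  rw [hn, eLpNorm_eq_lintegral_rpow_enorm_toReal (by simp) (by simp)]
  set a := Real.sqrt (1 / (8 * supM m * (n + 1))) with ha
  have ha2 : a ^ 2 = 1 / (8 * supM m * (n + 1)) := Real.sq_sqrt (by positivity)
  have ha0 : 0 ≤ a := Real.sqrt_nonneg _
  have htoReal : (1 / 2 : ℝ≥0∞).toReal = 1 / 2 := by simp
  rw [htoReal]
  have hlow : ENNReal.ofReal ((n : ℝ) / 2 * (a / (supM m) ^ 2)) ≤ ∫⁻ x,
      ‖fejer m (exampleMartingale m α) (bigQ m (n + 1)) x‖ₑ ^ (1 / 2 : ℝ) ∂(haar m) := by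
    -- Starting at $\lfloor n/2\rfloor$ ensures $n\le 2s+1$ and still leaves at least $n/2$ spikes.
    refine le_trans ?_ (setLIntegral_le_lintegral (⋃ s ∈ Finset.Ico (n / 2) n, spike m s) _)
    rw [lintegral_biUnion_finset (fun s _ t _ hst => ?_) fun s _ => measurableSet_spike m s]
    · refine le_trans ?_ (Finset.sum_le_sum fun s hs => le_setLIntegral_spike hm hbdd hα hn
        (Finset.mem_Ico.1 hs).2 (by have := (Finset.mem_Ico.1 hs).1; omega))
      rw [Finset.sum_const, Nat.card_Ico, ← ENNReal.ofReal_nsmul, nsmul_eq_mul]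
      refine ENNReal.ofReal_le_ofReal (mul_le_mul_of_nonneg_right ?_ (by positivity))
      rw [div_le_iff₀ two_pos]
      exact_mod_cast (by omega : n ≤ (n - n / 2) * 2)
    · rcases lt_or_gt_of_ne hst with h | h
      · exact disjoint_spike hm h
      · exact (disjoint_spike hm h).symm
  refine le_trans ?_ (ENNReal.rpow_le_rpow hlow (by norm_num))
  rw [ENNReal.ofReal_rpow_of_nonneg (by positivity) (by norm_num)]
  refine ENNReal.ofReal_le_ofReal ?_
  rw [one_div_one_div, Real.rpow_two, mul_pow, div_pow a, ha2, Nat.cast_add_one]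
  have h1 : (n : ℝ) - 1 ≤ n ^ 2 / (n + 1) := by
    rw [le_div_iff₀ (by positivity)]; nlinarith
  calc 1 / (32 * (supM m : ℝ) ^ 5) * ((n : ℝ) + 1 - 2)
      = 1 / (32 * (supM m : ℝ) ^ 5) * ((n : ℝ) - 1) := by ring
    _ ≤ 1 / (32 * (supM m : ℝ) ^ 5) * (n ^ 2 / (n + 1)) := by gcongr
    _ = _ := by field_simp; ring

theorem tendsto_eLpNorm_fejer_bigQ [∀ i, NeZero (m i)] (hm : ∀ i, 2 ≤ m i)
    (hbdd : BddAbove (Set.range m)) (hα : FastGrowing m α) :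
    Tendsto (fun k => eLpNorm (fejer m (exampleMartingale m α) (bigQ m (α k))) (1 / 2) (haar m))
      atTop (𝓝 ∞) := by
  have hsup := supM_pos hm hbdd
  -- The lower bound needs a preceding index for `lt_next`, so it starts at 1.
  rw [← tendsto_add_atTop_iff_nat 1]
  refine tendsto_nhds_top_mono ?_ (Eventually.of_forall fun k => le_eLpNorm_fejer_bigQ hm hbdd hα k)
  refine ENNReal.tendsto_ofReal_atTop.comp (Tendsto.const_mul_atTop (by positivity) ?_)
  refine tendsto_atTop_add_const_right _ _ ?_
  exact tendsto_natCast_atTop_atTop.comp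
    (hα.strictMono.tendsto_atTop.comp (tendsto_add_atTop_nat 1))

theorem exists_bigM_div_gt (hm : ∀ i, 2 ≤ m i) (C : ℝ) (N : ℕ) :
    ∃ n, N ≤ n ∧ C < (bigM m n : ℝ) / n := by
  have h1 : Tendsto (fun n : ℕ => (2 : ℝ) ^ n / (n : ℝ) ^ 1) atTop atTop := by
    have h := tendsto_pow_const_div_const_pow_of_one_lt 1 (r := (2 : ℝ)) (by norm_num)
    have h' : Tendsto (fun n : ℕ => (n : ℝ) ^ 1 / 2 ^ n) atTop (𝓝[>] 0) := by
      refine tendsto_nhdsWithin_iff.2 ⟨h, ?_⟩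
      filter_upwards [eventually_gt_atTop 0] with n hn
      have : (0 : ℝ) < n := by exact_mod_cast hn
      exact Set.mem_Ioi.2 (by positivity)
    exact h'.inv_tendsto_nhdsGT_zero.congr fun n => by simp
  obtain ⟨n, hn, hC⟩ := ((eventually_ge_atTop N).and (h1.eventually_gt_atTop C)).exists
  refine ⟨n, hn, hC.trans_le ?_⟩
  rw [pow_one]
  gcongr
  exact_mod_cast two_pow_le_bigM hm n

theorem exists_fastGrowing (hm : ∀ i, 2 ≤ m i) (hbdd : BddAbove (Set.range m)) :
    ∃ α : ℕ → ℕ, FastGrowing m α := by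
  -- The fourth power yields $\alpha_k^{-1/2}\le(k+1)^{-2}$, hence summability; the remaining terms
  -- force strict growth.
  have hstep : ∀ p : ℕ × ℕ, ∃ a : ℕ, (p.1 + 2) ^ 4 + p.2 + 1 ≤ a ∧
      32 * (supM m : ℝ) * (bigM m (2 * p.2) : ℝ) ^ 2 / p.2 < (bigM m a : ℝ) / a :=
    fun p => exists_bigM_div_gt hm _ _
  choose g hg1 hg2 using hstep
  obtain ⟨α, hα0, hα⟩ : ∃ α : ℕ → ℕ, α 0 = 1 ∧ ∀ k, α (k + 1) = g (k, α k) :=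
    ⟨fun k => Nat.rec 1 (fun k a => g (k, a)) k, rfl, fun _ => rfl⟩
  have h1 : ∀ k, (k + 2) ^ 4 + α k + 1 ≤ α (k + 1) := fun k => hα k ▸ hg1 (k, α k)
  have h2 : ∀ k, 32 * (supM m : ℝ) * (bigM m (2 * α k) : ℝ) ^ 2 / (α k : ℝ) <
    (bigM m (α (k + 1)) : ℝ) / (α (k + 1) : ℝ) := fun k => hα k ▸ hg2 (k, α k)
  have hpow : ∀ k, (k + 1) ^ 4 ≤ α k := fun k => by
    cases k with
    | zero => exact hα0.ge
    | succ k => exact (by omega : (k + 2) ^ 4 ≤ (k + 2) ^ 4 + α k + 1).trans (h1 k)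
  have hpos : ∀ k, 0 < α k := fun k => (by positivity : 0 < (k + 1) ^ 4).trans_le (hpow k)
  have hpos' : ∀ k, (0 : ℝ) < α k := fun k => by exact_mod_cast hpos k
  have hMpos : ∀ k, (0 : ℝ) < bigM m (2 * α k) := fun k => by exact_mod_cast bigM_pos hm _
  have hsup : (2 : ℝ) ≤ supM m := by exact_mod_cast (hm 0).trans (le_ciSup hbdd 0)
  refine ⟨α, strictMono_nat_of_lt_succ fun k => by have := h1 k; omega, hpos, ?_, fun k => ?_, h2⟩
  · have hs : Summable fun k : ℕ => ((k + 1 : ℕ) : ℝ) ^ (-2 : ℝ) :=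
      (summable_nat_add_iff 1).2 (Real.summable_nat_rpow.2 (by norm_num))
    refine Summable.of_nonneg_of_le (fun k => by positivity) (fun k => ?_) hs
    have h3 : (((k + 1 : ℕ) : ℝ) ^ (4 : ℝ)) ≤ α k := by
      have := hpow k
      rw [show (4 : ℝ) = ((4 : ℕ) : ℝ) by norm_num, Real.rpow_natCast]
      exact_mod_cast this
    have h4 := Real.rpow_le_rpow_of_nonpos (by positivity) h3 (by norm_num : (-(1 / 2) : ℝ) ≤ 0)
    rwa [← Real.rpow_mul (by positivity), show (4 : ℝ) * -(1 / 2) = -2 by norm_num] at h4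
  · induction k with
    | zero =>
      rw [Finset.sum_range_zero]
      have := hpos' 0
      have := hMpos 0
      positivity
    | succ k ih =>
      rw [Finset.sum_range_succ]
      set t := (bigM m (2 * α k) : ℝ) ^ 2 / α k with ht
      have ht0 : 0 < t := by
        have := hpos' k
        have := hMpos k
        positivity
      have h3 := h2 k
      rw [mul_div_assoc, ← ht] at h3
      have h4 : (bigM m (α (k + 1)) : ℝ) / α (k + 1) ≤
          (bigM m (2 * α (k + 1)) : ℝ) ^ 2 / α (k + 1) := by
        have h5 : bigM m (α (k + 1)) ≤ bigM m (2 * α (k + 1)) :=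
          (bigM_strictMono hm).monotone (by omega)
        have h6 : bigM m (2 * α (k + 1)) ≤ bigM m (2 * α (k + 1)) ^ 2 :=
          Nat.le_self_pow two_ne_zero _
        have h7 : (bigM m (α (k + 1)) : ℝ) ≤ (bigM m (2 * α (k + 1)) : ℝ) ^ 2 := by
          exact_mod_cast h5.trans h6
        gcongr
      -- `sum_lt` follows from `lt_next`: by induction the sum is below $2t$, and $2t\le 32Mt$.
      nlinarith

end Divergence
end Vilenkin

open Vilenkin
theorem theorem1 (m : ℕ → ℕ) (hm : ∀ i, 2 ≤ m i) (hbdd : BddAbove (Set.range m)) :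
    (∃ f : ℕ → VGroup m → ℂ, MemHardy m (1 / 2) f ∧
      (⨆ (n : ℕ) (_ : 1 ≤ n), eLpNorm (fejer m f n) (1 / 2) (haar m)) = ∞) ∧
    (∃ α : ℕ → ℕ, FastGrowing m α) ∧
    (∀ α : ℕ → ℕ, FastGrowing m α →
      MemHardy m (1 / 2) (exampleMartingale m α) ∧
      Tendsto (fun k => eLpNorm (fejer m (exampleMartingale m α) (bigQ m (α k))) (1 / 2) (haar m))
        atTop (𝓝 ∞)) := by
  have : ∀ i, NeZero (m i) := fun i => ⟨by have := hm i; omega⟩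
  obtain ⟨α, hα⟩ := exists_fastGrowing hm hbdd
  refine ⟨⟨exampleMartingale m α, memHardy_exampleMartingale hm hbdd hα, ?_⟩, ⟨α, hα⟩,
    fun β hβ => ⟨memHardy_exampleMartingale hm hbdd hβ, tendsto_eLpNorm_fejer_bigQ hm hbdd hβ⟩⟩
  refine top_le_iff.1 (le_of_tendsto' (tendsto_eLpNorm_fejer_bigQ hm hbdd hα) fun k => ?_)
  refine le_iSup₂_of_le (bigQ m (α k)) ?_ le_rfl
  obtain ⟨n, hn⟩ : ∃ n, α k = n + 1 := ⟨α k - 1, by have := hα.pos k; omega⟩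
  have := bigM_pos hm (2 * n + 2)
  rw [hn, bigQ_succ]
  omega
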